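/- **Conventions.** All Hilbert spaces are complex, nonzero and complete. A *self-dual cone* in a Hilbert space $\mathfrak H$ is a closed convex set $\mathfrak P\subset\mathfrak H$ with $t\mathfrak P\subseteq\mathfrak P$ for $t\ge 0$, $\mathfrak P\cap(-\mathfrak P)=\{0\}$ and $\mathfrak P=\{\eta\mid\langle\eta|\xi\rangle\ge 0\ \forall \xi\in\mathfrak P\}$. A vector $\eta\in\mathfrak P$ is *strictly positive* if $\langle\xi|\eta\rangle>0$ for all $\xi\in\mathfrak P\setminus\{0\}$. A bounded operator $A$ *preserves positivity* w.r.t. $\mathfrak P$ if $A\mathfrak P\subseteq\mathfrak P$, and *improves positivity* if $A\xi$ is strictly positive for every $\xi\in\mathfrak P\setminus\{0\}$. Let $\mathscr A^+_{\mathfrak P}$ be the set of self-adjoint operators $H$ on $\mathfrak H$ that are bounded from below, have purely discrete spectrum (isolated eigenvalues of finite multiplicity only), and are such that $(H+s)^{-1}$ improves positivity w.r.t. $\mathfrak P$ for all $s>-\inf\operatorname{spec}(H)$. Fix a Hilbert space $\mathfrak H_*$ and a bounded self-adjoint operator $O$ on it. If $\mathfrak H_*$ is a closed subspace of $\mathfrak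 H$, the operator $O\oplus 0$ on $\mathfrak H=\mathfrak H_*\oplus\mathfrak H_*^\perp$ is again denoted by $O$. Let $\mathscr P_0(O)$ be the class of all operators $H$ such that $H\in\mathscr A^+_{\mathfrak P}$ for some self-dual cone $\mathfrak P$ in some Hilbert space $\mathfrak H$ containing $\mathfrak H_*$ as a closed subspace, and such that $e^{isO}e^{itH}=e^{itH}e^{isO}$ for all $s,t\in\mathbb R$. For $H_1,H_2\in\mathscr P_0(O)$ acting in $\mathfrak H_1,\mathfrak H_2$ and self-dual cones $\mathfrak P_i\subset\mathfrak H_i$, write $(H_1,\mathfrak P_1)\to(H_2,\mathfrak P_2)$ if $H_i\in\mathscr A^+_{\mathfrak P_i}$ for $i=1,2$, $\mathfrak H_1$ is a closed subspace of $\mathfrak H_2$ (inclusion of Hilbert spaces being meant literally, as sets), and the orthogonal projection $\pi$ of $\mathfrak H_2$ onto $\mathfrak H_1$ satisfies $\pi\mathfrak P_2=\mathfrak P_1$ and $\pi\mathfrak P_2\subseteq\mathfrak P_2$. Write $H\to K$ if there are $N\ge 2$, operators $H=H_1,\dots,H_N=K$ in $\mathscr P_0(O)$ and cones $\mathfrak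 P_j,\mathfrak P_j'$ with $(H_j,\mathfrak P_j)\to(H_{j+1},\mathfrak P_{j+1}')$ for $1\le j<N$. This is a preorder; let $\mathscr P(O)$ be the induced partially ordered class of equivalence classes $[H]$ for the relation $H\to K$ and $K\to H$. The *stability class* of $[H]$ is $\mathscr U_O(H)=\{[K]\in\mathscr P(O)\mid [H]\to[K]\}$. **Theorem 3.4 (Richness).** For every $H\in\mathscr P_0(O)$, the cardinality of $\mathscr U_O(H)$ is strictly greater than $\aleph_0$; in particular $\mathscr U_O(H)$ is infinite. Moreover, for every self-dual cone $\mathfrak P$ with $H\in\mathscr A^+_{\mathfrak P}$ there is a sequence of pairs $(H_\ell,\mathfrak P_\ell)_{\ell\ge 0}$, with all $H_\ell\in\mathscr P_0(O)$, such that $(H_0,\mathfrak P_0)=(H,\mathfrak P)$; $(H_\ell,\mathfrak P_\ell)\to(H_{\ell+1},\mathfrak P_{\ell+1})$ for all $\ell\ge 0$; up to a unitary identification of the Hilbert space of $H_{\ell+1}$ with that of $H_\ell$ tensored with $\mathbb C^2$, $$H_{\ell+1}=H_\ell\otimes 1-1\otimes\sigma_1,\qquad \mathfrak P_{\ell+1}=\Big\{\Psi_1\otimes\tbinom10+\Psi_2\otimes\tbinom01\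 \Big|\ \Psi_1,\Psi_2\in\mathfrak P_\ell\Big\},\qquad \sigma_1=\begin{pmatrix}0&1\\1&0\end{pmatrix};$$ and the chain $[H_0]\to[H_1]\to[H_2]\to\cdots$ in $\mathscr U_O(H)$ is strictly increasing (its members are pairwise distinct). -/

import Mathlib

open scoped ComplexOrder InnerProductSpace

universe u

namespace Stability

/-! ### Self-dual cones and positivity -/

section Cones

variable {E : Type*} [NormedAddCommGroup E] [InnerProductSpace ℂ E]

/-- `P` is a self-dual convex cone in the complex Hilbert space `E`. For complex numbers,
`0 ≤ z` means that `z` is real and nonnegative. -/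
structure IsSelfDualCone (P : Set E) : Prop where
  closed : IsClosed P
  convex : Convex ℝ P
  smul_mem : ∀ t : ℝ, 0 ≤ t → ∀ x ∈ P, (t : ℂ) • x ∈ P
  pointed : P ∩ {x | -x ∈ P} = {0}
  self_dual : P = {y | ∀ x ∈ P, 0 ≤ ⟪y, x⟫_ℂ}

/-- `y > 0` with respect to `P`. -/
def StrictlyPositive (P : Set E) (y : E) : Prop :=
  y ∈ P ∧ ∀ x ∈ P, x ≠ 0 → 0 < ⟪x, y⟫_ℂ

/-- `A` preserves the positivity with respect to `P`. -/
def PreservesPositivity (P : Set E) (A : E →L[ℂ] E) : Prop :=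
  ∀ x ∈ P, A x ∈ P

/-- `A` improves the positivity with respect to `P`. -/
def ImprovesPositivity (P : Set E) (A : E →L[ℂ] E) : Prop :=
  ∀ x ∈ P, x ≠ 0 → StrictlyPositive P (A x)

end Cones

/-! ### Unbounded operators -/

section Operators

variable {E : Type*} [NormedAddCommGroup E] [InnerProductSpace ℂ E]

/-- `R` is the bounded everywhere defined inverse of `A - z`. -/
structure IsResolvent (A : E →ₗ.[ℂ] E) (z : ℂ) (R : E →L[ℂ] E) : Prop where
  right_inv : ∀ y : E, ∃ h : R y ∈ A.domain, A ⟨R y, h⟩ - z • R y = y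
  left_inv : ∀ x : A.domain, R (A x - z • (x : E)) = x

/-- The spectrum of `A`. -/
def spec (A : E →ₗ.[ℂ] E) : Set ℂ :=
  {z | ¬ ∃ R : E →L[ℂ] E, IsResolvent A z R}

/-- `inf spec(A)`, for operators with real spectrum. -/
noncomputable def groundEnergy (A : E →ₗ.[ℂ] E) : ℝ :=
  sInf {r : ℝ | (r : ℂ) ∈ spec A}

/-- The kernel of `A - z`. -/
def eigenspace (A : E →ₗ.[ℂ] E) (z : ℂ) : Submodule ℂ E where
  carrier := {x | ∃ h : x ∈ A.domain, A ⟨x, h⟩ = z • x}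
  zero_mem' := ⟨A.domain.zero_mem, by
    rw [smul_zero]
    exact A.map_zero⟩
  add_mem' := by
    rintro x y ⟨hx, ex⟩ ⟨hy, ey⟩
    refine ⟨A.domain.add_mem hx hy, ?_⟩
    have h := A.map_add ⟨x, hx⟩ ⟨y, hy⟩
    rw [ex, ey] at h
    rw [smul_add]
    exact h
  smul_mem' := by
    rintro c x ⟨hx, ex⟩
    refine ⟨A.domain.smul_mem c hx, ?_⟩
    have h := A.map_smul c ⟨x, hx⟩
    rw [ex] at h
    rw [smul_comm]
    exact h

def BoundedBelow (A : E →ₗ.[ℂ] E) : Prop :=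
  ∃ c : ℝ, ∀ x : A.domain, c * ‖(x : E)‖ ^ 2 ≤ (⟪(x : E), A x⟫_ℂ).re

/-- Purely discrete spectrum: every point of the spectrum is an isolated point of it and an
eigenvalue of finite multiplicity. -/
def PurelyDiscreteSpectrum (A : E →ₗ.[ℂ] E) : Prop :=
  ∀ z ∈ spec A,
    (∃ ε : ℝ, 0 < ε ∧ ∀ w ∈ spec A, dist w z < ε → w = z) ∧
    eigenspace A z ≠ ⊥ ∧ FiniteDimensional ℂ (eigenspace A z)

variable [CompleteSpace E]

/-- The class of operators attached to the cone `P`: `A` is self-adjoint, bounded from below, has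
purely discrete spectrum, and `(A + s)⁻¹` improves the positivity with respect to `P` for every
`s > -inf spec(A)`. -/
structure IsPositivityImproving (P : Set E) (A : E →ₗ.[ℂ] E) : Prop where
  selfAdjoint : IsSelfAdjoint A
  boundedBelow : BoundedBelow A
  discrete : PurelyDiscreteSpectrum A
  improves : ∀ s : ℝ, -groundEnergy A < s →
    ∃ R : E →L[ℂ] E, IsResolvent A (-(s : ℂ)) R ∧ ImprovesPositivity P R

/-- `U t = exp(i t A)` for all real `t`: `U` is the strongly continuous one-parameter unitary
group with generator `A` in the sense of Stone's theorem. -/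
structure IsUnitaryGroupOf (A : E →ₗ.[ℂ] E) (U : ℝ → E →L[ℂ] E) : Prop where
  unitary : ∀ t, U t ∈ unitary (E →L[ℂ] E)
  map_zero : U 0 = 1
  map_add : ∀ s t, U (s + t) = U s * U t
  continuous : ∀ x, Continuous fun t => U t x
  generator : ∀ x y : E, HasDerivAt (fun t => U t x) (Complex.I • y) 0 ↔
    ∃ h : x ∈ A.domain, A ⟨x, h⟩ = y

/-- `exp(i s B)` and `exp(i t A)` commute for all real `s`, `t`; here `B` is bounded. -/
def StronglyCommute (B : E →L[ℂ] E) (A : E →ₗ.[ℂ] E) : Prop :=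
  ∃ U : ℝ → E →L[ℂ] E, IsUnitaryGroupOf A U ∧
    ∀ s t : ℝ, Commute (NormedSpace.exp ((Complex.I * (s : ℂ)) • B)) (U t)

end Operators

/-! ### Hilbert spaces as sets, and closed subspaces -/

/-- A nonzero complex Hilbert space whose underlying set is a set of the set-theoretic universe,
so that inclusion of one Hilbert space in another has its literal meaning. -/
structure HilbertSpace where
  carrier : ZFSet.{u}
  [normed : NormedAddCommGroup carrier]
  [inner : InnerProductSpace ℂ carrier]
  [complete : CompleteSpace carrier]
  [nontrivial : Nontrivial carrier]

instance : CoeSort HilbertSpace.{u} (Type (u + 1)) := ⟨fun X => X.carrier⟩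

attribute [instance] HilbertSpace.normed HilbertSpace.inner HilbertSpace.complete
  HilbertSpace.nontrivial

/-- `X` is a closed subspace of `Y`: the underlying set of `X` is a subset of that of `Y` and the
inclusion map is linear and isometric (closedness follows since `X` is complete). -/
def IsClosedSubspace (X Y : HilbertSpace.{u}) : Prop :=
  ∃ j : X →ₗᵢ[ℂ] Y, ∀ x : X, (j x : ZFSet.{u}) = (x : ZFSet.{u})

namespace IsClosedSubspace

variable {X Y : HilbertSpace.{u}}

/-- The inclusion map. -/
noncomputable def incl (h : IsClosedSubspace X Y) : X →ₗᵢ[ℂ] Y := h.choose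

/-- The orthogonal projection of `Y` onto `X`, with values in `X`. -/
noncomputable def toSub (h : IsClosedSubspace X Y) : Y →L[ℂ] X :=
  ContinuousLinearMap.adjoint h.incl.toContinuousLinearMap

/-- The orthogonal projection of `Y` onto `X`, as an operator on `Y`. -/
noncomputable def proj (h : IsClosedSubspace X Y) : Y →L[ℂ] Y :=
  h.incl.toContinuousLinearMap ∘L h.toSub

/-- The natural extension `B ⊕ 0` of an operator `B` on `X` to `Y = X ⊕ Xᗮ`. -/
noncomputable def extend (h : IsClosedSubspace X Y) (B : X →L[ℂ] X) : Y →L[ℂ] Y :=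
  h.incl.toContinuousLinearMap ∘L B ∘L h.toSub

theorem coe_incl (h : IsClosedSubspace X Y) (x : X) :
    (h.incl x : ZFSet.{u}) = (x : ZFSet.{u}) := h.choose_spec x

theorem toSub_incl (h : IsClosedSubspace X Y) (x : X) : h.toSub (h.incl x) = x := by
  refine ext_inner_left ℂ fun v => ?_
  rw [toSub, ContinuousLinearMap.adjoint_inner_right]
  exact h.incl.inner_map_map v x

/-- `proj` is the orthogonal projection onto the image of the inclusion. -/
theorem proj_mem_and_orthogonal (h : IsClosedSubspace X Y) (y : Y) :
    h.proj y ∈ LinearMap.range h.incl.toLinearMap ∧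
      y - h.proj y ∈ (LinearMap.range h.incl.toLinearMap)ᗮ := by
  refine ⟨⟨h.toSub y, rfl⟩, ?_⟩
  rw [Submodule.mem_orthogonal]
  rintro _ ⟨x, rfl⟩
  have h1 : ⟪h.incl x, y⟫_ℂ = ⟪x, h.toSub y⟫_ℂ := by
    rw [toSub, ContinuousLinearMap.adjoint_inner_right]; rfl
  have h2 : ⟪h.incl x, h.proj y⟫_ℂ = ⟪x, h.toSub y⟫_ℂ := h.incl.inner_map_map x _
  rw [inner_sub_right]
  exact sub_eq_zero.2 (h1.trans h2.symm)

theorem refl (X : HilbertSpace.{u}) : IsClosedSubspace X X :=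
  ⟨LinearIsometry.id, fun _ => rfl⟩

theorem incl_self (h : IsClosedSubspace X X) (x : X) : h.incl x = x :=
  Subtype.ext (h.coe_incl x)

theorem proj_self (h : IsClosedSubspace X X) (x : X) : h.proj x = x := by
  have h1 := h.toSub_incl x
  rw [h.incl_self] at h1
  change h.incl (h.toSub x) = x
  rw [h1, h.incl_self]

end IsClosedSubspace

/-- The positivity is inherited from the cone `P` in `X` to the cone `Q` in `Y ⊇ X`. -/
def ConeInherited {X Y : HilbertSpace.{u}} (P : Set X) (Q : Set Y) : Prop :=
  ∃ h : IsClosedSubspace X Y, h.incl '' P = h.proj '' Q ∧ PreservesPositivity Q h.proj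

/-! ### Hamiltonians, the preorder, and stability classes -/

/-- The self-adjoint operators `H`, acting in some Hilbert space containing `X₀` as a closed
subspace, which belong to the class `IsPositivityImproving P` for some self-dual cone `P` in that
Hilbert space, and which commute strongly with (the natural extension of) the bounded
operator `O` on `X₀`. -/
structure Hamiltonian (X₀ : HilbertSpace.{u}) (O : X₀ →L[ℂ] X₀) where
  space : HilbertSpace.{u}
  sub : IsClosedSubspace X₀ space
  op : space →ₗ.[ℂ] space
  exists_cone : ∃ P : Set space, IsSelfDualCone P ∧ IsPositivityImproving P op
  commute : StronglyCommute (sub.extend O) op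

variable {X₀ : HilbertSpace.{u}} {O : X₀ →L[ℂ] X₀}

/-- `(H, P) → (K, Q)`: the strict `Q`-positivity of `K` is inherited from the strict `P`-positivity
of `H`. -/
structure StrictlyInherited (H : Hamiltonian X₀ O) (P : Set H.space)
    (K : Hamiltonian X₀ O) (Q : Set K.space) : Prop where
  cone_left : IsSelfDualCone P
  cone_right : IsSelfDualCone Q
  left : IsPositivityImproving P H.op
  right : IsPositivityImproving Q K.op
  inherited : ConeInherited P Q

/-- `H → K`: there is a finite chain
`(H₁, P₁) → (H₂, P₂')`, `(H₂, P₂) → (H₃, P₃')`, ..., `(Hₙ₋₁, Pₙ₋₁) → (Hₙ, Pₙ')`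
with `H₁ = H` and `Hₙ = K`. -/
def Connected (H K : Hamiltonian X₀ O) : Prop :=
  Relation.TransGen (fun H K : Hamiltonian X₀ O => ∃ P Q, StrictlyInherited H P K Q) H K

theorem connected_refl (H : Hamiltonian X₀ O) : Connected H H := by
  obtain ⟨P, hP, hH⟩ := H.exists_cone
  refine Relation.TransGen.single ⟨P, P, hP, hP, hH, hH, IsClosedSubspace.refl _, ?_, ?_⟩
  · exact Set.image_congr fun x _ => by
      rw [IsClosedSubspace.incl_self, IsClosedSubspace.proj_self]
  · intro x hx
    rwa [IsClosedSubspace.proj_self]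

/-- The preorder `→`; `H ≤ K` is `H → K`. -/
instance : Preorder (Hamiltonian X₀ O) where
  le := Connected
  le_refl := connected_refl
  le_trans _ _ _ h₁ h₂ := Relation.TransGen.trans h₁ h₂

/-- Equivalence classes of Hamiltonians for `H ≡ K ↔ (H → K ∧ K → H)`, with the partial
order induced by `→`. -/
abbrev HamiltonianClass (X₀ : HilbertSpace.{u}) (O : X₀ →L[ℂ] X₀) : Type (u + 1) :=
  Antisymmetrization (Hamiltonian X₀ O) (· ≤ ·)

/-- The equivalence class `[H]`. -/
def toClass (H : Hamiltonian X₀ O) : HamiltonianClass X₀ O :=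
  toAntisymmetrization (· ≤ ·) H

/-- The stability class of `[H]`: all `[K]` with `[H] → [K]`. -/
def stabilityClass (H : HamiltonianClass X₀ O) : Set (HamiltonianClass X₀ O) :=
  {K | H ≤ K}

/-- Under a unitary identification `V` of the Hilbert space of `K` with `H.space ⊗ ℂ²`, i.e. with
pairs `(Ψ₁, Ψ₂)` standing for `Ψ₁ ⊗ e₁ + Ψ₂ ⊗ e₂`, the operator of `K` is
`H ⊗ 1 - 1 ⊗ σ₁`, i.e. `(Ψ₁, Ψ₂) ↦ (H Ψ₁ - Ψ₂, H Ψ₂ - Ψ₁)` on pairs from the domain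
of `H`, and the cone `Q` is `P ⊕ P`. -/
def IsSpinDoubling (H : Hamiltonian X₀ O) (P : Set H.space)
    (K : Hamiltonian X₀ O) (Q : Set K.space) : Prop :=
  ∃ V : K.space ≃ₗᵢ[ℂ] WithLp 2 (H.space × H.space),
    (∀ x y : K.space,
      (∃ h : x ∈ K.op.domain, K.op ⟨x, h⟩ = y) ↔
        ∃ (h₁ : (V x).fst ∈ H.op.domain) (h₂ : (V x).snd ∈ H.op.domain),
          (V y).fst = H.op ⟨(V x).fst, h₁⟩ - (V x).snd ∧
          (V y).snd = H.op ⟨(V x).snd, h₂⟩ - (V x).fst) ∧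
    ∀ x : K.space, x ∈ Q ↔ (V x).fst ∈ P ∧ (V x).snd ∈ P

end Stability

/-! Rotating `ℂ²` by the Hadamard matrix turns `σ₁` into `diag(1, -1)`, so `H ⊗ 1 - 1 ⊗ σ₁` becomes
`(H - 1) ⊕ (H + 1)`, the operator `shiftSum`. Self-adjointness, semiboundedness, discrete spectrum
and commutation with `O ⊕ 0` can be read off the two summands. The old space is the first summand,
that is, `Ψ ↦ Ψ ⊗ (e₁ + e₂)/√2`.

Positivity refers to `P ⊕ P` in the unrotated coordinates. With `R = (H + s - 1)⁻¹` and `S = (H + s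
+ 1)⁻¹`, the resolvent there is a 2×2 matrix with diagonal entries `(R + S)/2` and off-diagonal
entries `(R - S)/2`. The resolvent identity gives `(R - S)/2 = R S`, so all four entries improve
positivity (`ImprovesPositivity.diag`). The projection onto the old space averages the two
components, so it preserves `P ⊕ P` and maps it onto the image of `P` (`coneInherited_double`).

Strictness and uncountability rest on inclusion being literal: `H → K` forces the carrier of `H`
into that of `K` (`carrier_subset_of_le`). The doubled space has the old carrier plus new sets, so
there is no way back. The new sets can carry an arbitrary tag, different tags give incomparable
doubles, and ordinals serve as uncountably many tags. -/

namespace Stability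

/-! ### Resolvents, discrete spectrum and self-adjointness. -/

section Resolvents

variable {E : Type*} [NormedAddCommGroup E] [InnerProductSpace ℂ E]
  {A : E →ₗ.[ℂ] E} {z w : ℂ} {R S : E →L[ℂ] E}

/-- The first resolvent identity. -/
theorem IsResolvent.sub_apply (hR : IsResolvent A z R) (hS : IsResolvent A w S) (y : E) :
    R y - S y = (z - w) • R (S y) := by
  obtain ⟨h, e⟩ := hS.right_inv y
  have h1 := hR.left_inv ⟨S y, h⟩
  rw [sub_eq_iff_eq_add.1 e] at h1
  simp only [map_sub, map_add, map_smul] at h1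
  rw [sub_smul]
  rw [← sub_eq_zero] at h1 ⊢
  rw [← h1]
  abel

theorem notMem_spec_iff : z ∉ spec A ↔ ∃ R : E →L[ℂ] E, IsResolvent A z R := not_not

theorem mem_spec_of_eigenspace_ne_bot (h : eigenspace A z ≠ ⊥) : z ∈ spec A := by
  obtain ⟨x, ⟨hx, e⟩, h0⟩ := Submodule.exists_mem_ne_zero_of_ne_bot h
  rintro ⟨R, hR⟩
  have h1 := hR.left_inv ⟨x, hx⟩
  rw [e, sub_self, map_zero] at h1
  exact h0 h1.symm

/-- An eigenvector satisfies `x = (w - z) • R x`, so eigenvalues cannot approach a resolvent point.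
-/
theorem IsResolvent.one_le_dist_mul (hR : IsResolvent A z R) (h : eigenspace A w ≠ ⊥) :
    1 ≤ dist w z * ‖R‖ := by
  obtain ⟨x, ⟨hx, e⟩, h0⟩ := Submodule.exists_mem_ne_zero_of_ne_bot h
  have h1 := hR.left_inv ⟨x, hx⟩
  rw [e, ← sub_smul, map_smul] at h1
  have h2 : ‖x‖ ≤ dist w z * ‖R‖ * ‖x‖ := by
    calc ‖x‖ = ‖(w - z) • R x‖ := by rw [h1]
      _ = dist w z * ‖R x‖ := by rw [norm_smul, dist_eq_norm]
      _ ≤ dist w z * (‖R‖ * ‖x‖) := by gcongr; exact R.le_opNorm x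
      _ = _ := by ring
  have h3 : 0 < ‖x‖ := norm_pos_iff.2 h0
  exact le_of_mul_le_mul_right (by linarith) h3

/-- The definition isolates only points of the spectrum. For the direct sum, isolation is needed
around both `z + 1` and `z - 1`, one of which may lie outside it. -/
theorem PurelyDiscreteSpectrum.exists_dist_lt_imp_eq (h : PurelyDiscreteSpectrum A) (z : ℂ) :
    ∃ ε : ℝ, 0 < ε ∧ ∀ w ∈ spec A, dist w z < ε → w = z := by
  by_cases hz : z ∈ spec A
  · exact (h z hz).1
  · obtain ⟨R, hR⟩ := notMem_spec_iff.1 hz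
    -- The `+ 1` spares a separate treatment of `R = 0`.
    refine ⟨(‖R‖ + 1)⁻¹, by positivity, fun w hw hd => ?_⟩
    have h1 := hR.one_le_dist_mul (h w hw).2.1
    have h2 : dist w z * (‖R‖ + 1) < 1 := by
      rwa [← lt_div_iff₀ (by positivity), one_div]
    nlinarith [dist_nonneg (x := w) (y := z)]

/-- A complex number is the eigenvalue of a symmetric operator only if it is real. -/
theorem conj_eq_of_eigenspace_ne_bot (hA : A.IsFormalAdjoint A) (h : eigenspace A z ≠ ⊥) :
    (starRingEnd ℂ) z = z := by
  obtain ⟨x, ⟨hx, e⟩, h0⟩ := Submodule.exists_mem_ne_zero_of_ne_bot h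
  have h1 := hA ⟨x, hx⟩ ⟨x, hx⟩
  rw [e, inner_smul_left, inner_smul_right] at h1
  exact mul_right_cancel₀ (inner_self_ne_zero.2 h0) h1

theorem le_re_of_eigenspace_ne_bot {c : ℝ}
    (hc : ∀ x : A.domain, c * ‖(x : E)‖ ^ 2 ≤ (⟪(x : E), A x⟫_ℂ).re) (h : eigenspace A z ≠ ⊥) :
    c ≤ z.re := by
  obtain ⟨x, ⟨hx, e⟩, h0⟩ := Submodule.exists_mem_ne_zero_of_ne_bot h
  have h1 := hc ⟨x, hx⟩
  rw [e, inner_smul_right, inner_self_eq_norm_sq_to_K] at h1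
  have h2 : (0 : ℝ) < ‖x‖ ^ 2 := by positivity
  refine le_of_mul_le_mul_right (h1.trans_eq ?_) h2
  rw [← Complex.re_mul_ofReal]
  norm_cast

theorem PurelyDiscreteSpectrum.bddBelow (hd : PurelyDiscreteSpectrum A) (hb : BoundedBelow A) :
    BddBelow {r : ℝ | (r : ℂ) ∈ spec A} := by
  obtain ⟨c, hc⟩ := hb
  exact ⟨c, fun r hr => by simpa using le_re_of_eigenspace_ne_bot hc (hd r hr).2.1⟩

variable [CompleteSpace E]

theorem IsResolvent.isSelfAdjoint {r : ℝ} (hA : A.IsFormalAdjoint A)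
    (hR : IsResolvent A (r : ℂ) R) : IsSelfAdjoint R := by
  rw [ContinuousLinearMap.isSelfAdjoint_iff_isSymmetric]
  intro x y
  obtain ⟨hx, ex⟩ := hR.right_inv x
  obtain ⟨hy, ey⟩ := hR.right_inv y
  have h := hA ⟨R x, hx⟩ ⟨R y, hy⟩
  change ⟪R x, y⟫_ℂ = ⟪x, R y⟫_ℂ
  nth_rewrite 2 [← ex]
  nth_rewrite 1 [← ey]
  rw [inner_sub_left, inner_sub_right, inner_smul_left, inner_smul_right, Complex.conj_ofReal, h]

/-- A symmetric operator with a real resolvent point is self-adjoint: symmetry of `R` yields both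
the density of the domain and the inclusion of the adjoint's domain in it. -/
theorem isSelfAdjoint_of_isResolvent {r : ℝ} (hA : A.IsFormalAdjoint A)
    (hR : IsResolvent A (r : ℂ) R) : IsSelfAdjoint A := by
  have hRs : ∀ x y, ⟪R x, y⟫_ℂ = ⟪x, R y⟫_ℂ :=
    (ContinuousLinearMap.isSelfAdjoint_iff_isSymmetric.1 (hR.isSelfAdjoint hA))
  have hdense : Dense (A.domain : Set E) := by
    rw [Submodule.dense_iff_topologicalClosure_eq_top, Submodule.topologicalClosure_eq_top_iff,
      Submodule.eq_bot_iff]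
    intro y hy
    have h0 : R y = 0 := by
      refine ext_inner_left ℂ fun x => ?_
      rw [← hRs, inner_zero_right]
      exact (Submodule.mem_orthogonal _ _).1 hy _ (hR.right_inv x).1
    obtain ⟨h, e⟩ := hR.right_inv y
    have h1 : (⟨R y, h⟩ : A.domain) = 0 := Subtype.ext h0
    rw [h1, A.map_zero, h0] at e
    simpa using e.symm
  have hle : A ≤ A.adjoint := LinearPMap.IsFormalAdjoint.le_adjoint hdense hA
  rw [LinearPMap.isSelfAdjoint_def]
  refine (LinearPMap.eq_of_le_of_domain_eq hle (le_antisymm hle.1 fun y hy => ?_)).symm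
  -- If `y` lies in the domain, it must equal `u = R ((A† - r) y)`. Testing against `v = (A - r) R
  -- v` confirms this equality.
  obtain ⟨h, e⟩ := hR.right_inv (A.adjoint ⟨y, hy⟩ - (r : ℂ) • y)
  set u := R (A.adjoint ⟨y, hy⟩ - (r : ℂ) • y) with hu
  have key : y = u := by
    refine ext_inner_right ℂ fun v => ?_
    obtain ⟨hv, ev⟩ := hR.right_inv v
    have h1 := LinearPMap.adjoint_isFormalAdjoint hdense ⟨y, hy⟩ ⟨R v, hv⟩
    rw [hu, hRs, inner_sub_left, inner_smul_left, Complex.conj_ofReal]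
    nth_rewrite 1 [← ev]
    rw [inner_sub_right, inner_smul_right]
    rw [h1]
  rw [key]
  exact h

/-- With empty spectrum, `R = A⁻¹` would be bounded, self-adjoint and without nonzero spectrum. Its
norm, equal to its spectral radius, would vanish. Nonemptiness makes `groundEnergy` a genuine
infimum rather than the default value of `sInf ∅`. -/
theorem spec_nonempty [Nontrivial E] (hA : A.IsFormalAdjoint A) : (spec A).Nonempty := by
  by_contra hne
  have hres : ∀ z, ∃ R : E →L[ℂ] E, IsResolvent A z R := fun z =>
    notMem_spec_iff.1 fun hz => hne ⟨z, hz⟩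
  obtain ⟨R, hR⟩ := hres 0
  have hR' : IsResolvent A ((0 : ℝ) : ℂ) R := by simpa using hR
  have hspec : ∀ z ∈ spectrum ℂ R, z = 0 := by
    intro l hl
    by_contra h0
    obtain ⟨S, hS⟩ := hres l⁻¹
    refine hl ?_
    have h1 : ∀ y, S y - R y = l⁻¹ • R (S y) := fun y => by
      rw [← neg_sub, hR.sub_apply hS, zero_sub, neg_smul, neg_neg]
    have h2 : ∀ y, S y - R y = l⁻¹ • S (R y) := fun y => by
      rw [hS.sub_apply hR, sub_zero]
    have hunit : ∀ y, l • S y - l • R y = R (S y) := fun y => by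
      rw [← smul_sub, h1, smul_smul, mul_inv_cancel₀ h0, one_smul]
    have hunit' : ∀ y, l • S y - l • R y = S (R y) := fun y => by
      rw [← smul_sub, h2, smul_smul, mul_inv_cancel₀ h0, one_smul]
    -- From `l - A⁻¹ = l A⁻¹ (A - l⁻¹)` the inverse is `l⁻¹ A S`, and `A S = 1 + l⁻¹ S`.
    refine ⟨⟨algebraMap ℂ (E →L[ℂ] E) l - R, l⁻¹ • (1 + l⁻¹ • S), ?_, ?_⟩, rfl⟩
    · ext y
      have := hunit y
      simp only [mul_apply_eq_comp, Algebra.algebraMap_eq_smul_one,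
        sub_apply, smul_apply,
        one_apply_eq_self, add_apply, map_smul, map_add,
        ← this]
      match_scalars <;> field_simp <;> simp
    · ext y
      have := hunit' y
      simp only [mul_apply_eq_comp, Algebra.algebraMap_eq_smul_one,
        sub_apply, smul_apply,
        one_apply_eq_self, add_apply, map_smul, map_sub,
        ← this]
      match_scalars <;> field_simp <;> simp
  have hrad := (hR'.isSelfAdjoint hA).spectralRadius_eq_nnnorm
  have h0 : spectralRadius ℂ R = 0 := by
    simp only [spectralRadius, ENNReal.iSup_eq_zero]
    intro z hz
    simp [hspec z hz]
  have hR0 : R = 0 := by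
    rw [h0] at hrad
    simpa using hrad.symm
  obtain ⟨y, hy⟩ := exists_ne (0 : E)
  obtain ⟨h, e⟩ := hR.right_inv y
  have h1 : (⟨R y, h⟩ : A.domain) = 0 := Subtype.ext (by simp [hR0])
  rw [h1, A.map_zero, hR0] at e
  exact hy (by simpa using e.symm)

theorem IsPositivityImproving.isFormalAdjoint {P : Set E} (h : IsPositivityImproving P A) :
    A.IsFormalAdjoint A := by
  have h1 := LinearPMap.adjoint_isFormalAdjoint h.selfAdjoint.dense_domain
  rwa [LinearPMap.isSelfAdjoint_def.1 h.selfAdjoint] at h1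

theorem IsPositivityImproving.exists_real_mem_spec [Nontrivial E] {P : Set E}
    (h : IsPositivityImproving P A) : {r : ℝ | (r : ℂ) ∈ spec A}.Nonempty := by
  obtain ⟨z, hz⟩ := spec_nonempty h.isFormalAdjoint
  refine ⟨z.re, ?_⟩
  rwa [Set.mem_ofPred_eq, Complex.conj_eq_iff_re.1
    (conj_eq_of_eigenspace_ne_bot h.isFormalAdjoint (h.discrete z hz).2.1)]

end Resolvents

/-! ### The direct sum `(A - 1) ⊕ (A + 1)` and its spectrum. -/

section Doubling

variable {E F : Type*} [NormedAddCommGroup E] [InnerProductSpace ℂ E]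
  [NormedAddCommGroup F] [InnerProductSpace ℂ F]
  (W : F ≃ₗᵢ[ℂ] WithLp 2 (E × E))

theorem ext_fst_snd {x y : F} (h₁ : (W x).fst = (W y).fst) (h₂ : (W x).snd = (W y).snd) :
    x = y :=
  W.injective (WithLp.ofLp_injective 2 (Prod.ext h₁ h₂))

theorem inner_eq_fst_add_snd (x y : F) :
    ⟪x, y⟫_ℂ = ⟪(W x).fst, (W y).fst⟫_ℂ + ⟪(W x).snd, (W y).snd⟫_ℂ := by
  rw [← W.inner_map_map, WithLp.prod_inner_apply]
  rfl

/-- The operator `B ⊕ C`, transported along `W`. -/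
noncomputable def diag (B C : E →L[ℂ] E) : F →L[ℂ] F :=
  W.symm.toContinuousLinearEquiv.toContinuousLinearMap ∘L
    (WithLp.prodContinuousLinearEquiv 2 ℂ E E).symm.toContinuousLinearMap ∘L
      (B.prodMap C) ∘L (WithLp.prodContinuousLinearEquiv 2 ℂ E E).toContinuousLinearMap ∘L
        W.toContinuousLinearEquiv.toContinuousLinearMap

theorem map_diag (B C : E →L[ℂ] E) (x : F) :
    W (diag W B C x) = WithLp.toLp 2 (B (W x).fst, C (W x).snd) :=
  W.apply_symm_apply _

@[simp]
theorem fst_diag (B C : E →L[ℂ] E) (x : F) : (W (diag W B C x)).fst = B (W x).fst := by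
  rw [map_diag]
  rfl

@[simp]
theorem snd_diag (B C : E →L[ℂ] E) (x : F) : (W (diag W B C x)).snd = C (W x).snd := by
  rw [map_diag]
  rfl

theorem diag_mul (B C B' C' : E →L[ℂ] E) :
    diag W (B * B') (C * C') = diag W B C * diag W B' C' :=
  ContinuousLinearMap.ext fun x => ext_fst_snd W (by simp) (by simp)

theorem diag_one : diag W 1 1 = 1 :=
  ContinuousLinearMap.ext fun x => ext_fst_snd W (by simp) (by simp)

theorem star_diag [CompleteSpace E] [CompleteSpace F] (B C : E →L[ℂ] E) :
    star (diag W B C) = diag W (star B) (star C) := by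
  rw [ContinuousLinearMap.star_eq_adjoint, eq_comm, ContinuousLinearMap.eq_adjoint_iff]
  intro x y
  simp [inner_eq_fst_add_snd W, ContinuousLinearMap.star_eq_adjoint,
    ContinuousLinearMap.adjoint_inner_left]

theorem diag_mem_unitary [CompleteSpace E] [CompleteSpace F] {B C : E →L[ℂ] E}
    (hB : B ∈ unitary (E →L[ℂ] E)) (hC : C ∈ unitary (E →L[ℂ] E)) :
    diag W B C ∈ unitary (F →L[ℂ] F) := by
  rw [Unitary.mem_iff] at *
  simp only [star_diag, ← diag_mul, hB, hC, diag_one, and_self]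

/-- The domain of `(A - 1) ⊕ (A + 1)`, transported along `W`. -/
noncomputable def shiftSumDomain (A : E →ₗ.[ℂ] E) : Submodule ℂ F :=
  A.domain.comap ((WithLp.fstₗ 2 ℂ E E).comp W.toLinearEquiv.toLinearMap) ⊓
    A.domain.comap ((WithLp.sndₗ 2 ℂ E E).comp W.toLinearEquiv.toLinearMap)

theorem fst_mem_domain {A : E →ₗ.[ℂ] E} (x : shiftSumDomain W A) : (W x).fst ∈ A.domain := x.2.1

theorem snd_mem_domain {A : E →ₗ.[ℂ] E} (x : shiftSumDomain W A) : (W x).snd ∈ A.domain := x.2.2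

/-- The operator `(A - 1) ⊕ (A + 1)`, transported along `W`. -/
noncomputable def shiftSum (A : E →ₗ.[ℂ] E) : F →ₗ.[ℂ] F where
  domain := shiftSumDomain W A
  toFun :=
    { toFun x := W.symm (WithLp.toLp 2
        (A ⟨(W x).fst, fst_mem_domain W x⟩ - (W x).fst,
          A ⟨(W x).snd, snd_mem_domain W x⟩ + (W x).snd))
      map_add' x y := by
        have h₁ := A.map_add ⟨(W x).fst, fst_mem_domain W x⟩ ⟨(W y).fst, fst_mem_domain W y⟩
        have h₂ := A.map_add ⟨(W x).snd, snd_mem_domain W x⟩ ⟨(W y).snd, snd_mem_domain W y⟩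
        simp only [AddMemClass.mk_add_mk] at h₁ h₂
        refine ext_fst_snd W ?_ ?_
        · simp [h₁]; abel
        · simp [h₂]; abel
      map_smul' c x := by
        have h₁ := A.map_smul c ⟨(W x).fst, fst_mem_domain W x⟩
        have h₂ := A.map_smul c ⟨(W x).snd, snd_mem_domain W x⟩
        simp only [SetLike.mk_smul_mk] at h₁ h₂
        refine ext_fst_snd W ?_ ?_
        · simp [h₁, smul_sub]
        · simp [h₂, smul_add] }

variable {A : E →ₗ.[ℂ] E} {z : ℂ}

@[simp]
theorem fst_shiftSum (x : (shiftSum W A).domain) :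
    (W (shiftSum W A x)).fst = A ⟨(W x).fst, x.2.1⟩ - (W x).fst := by
  change (W (W.symm _)).fst = _
  rw [W.apply_symm_apply]
  rfl

@[simp]
theorem snd_shiftSum (x : (shiftSum W A).domain) :
    (W (shiftSum W A x)).snd = A ⟨(W x).snd, x.2.2⟩ + (W x).snd := by
  change (W (W.symm _)).snd = _
  rw [W.apply_symm_apply]
  rfl

theorem shiftSum_eq_iff (x y : F) :
    (∃ h : x ∈ (shiftSum W A).domain, shiftSum W A ⟨x, h⟩ = y) ↔
      (∃ h : (W x).fst ∈ A.domain, A ⟨(W x).fst, h⟩ = (W y).fst + (W x).fst) ∧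
        ∃ h : (W x).snd ∈ A.domain, A ⟨(W x).snd, h⟩ = (W y).snd - (W x).snd := by
  constructor
  · rintro ⟨h, rfl⟩
    refine ⟨⟨h.1, ?_⟩, h.2, ?_⟩
    · simp
    · simp
  · rintro ⟨⟨h₁, e₁⟩, h₂, e₂⟩
    refine ⟨⟨h₁, h₂⟩, ext_fst_snd W ?_ ?_⟩
    · simp [e₁]
    · simp [e₂]

theorem IsResolvent.diag {R S : E →L[ℂ] E} (hR : IsResolvent A (z + 1) R)
    (hS : IsResolvent A (z - 1) S) : IsResolvent (shiftSum W A) z (diag W R S) where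
  right_inv y := by
    obtain ⟨h₁, e₁⟩ := hR.right_inv (W y).fst
    obtain ⟨h₂, e₂⟩ := hS.right_inv (W y).snd
    rw [sub_eq_iff_eq_add] at e₁ e₂
    obtain ⟨h, e⟩ := (shiftSum_eq_iff W (A := A) (Stability.diag W R S y)
      (y + z • Stability.diag W R S y)).2 ⟨by
        simp only [fst_diag, map_add, map_smul, WithLp.add_fst, WithLp.smul_fst]
        exact ⟨h₁, by rw [e₁]; module⟩, by
        simp only [snd_diag, map_add, map_smul, WithLp.add_snd, WithLp.smul_snd]
        exact ⟨h₂, by rw [e₂]; module⟩⟩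
    exact ⟨h, by rw [e, add_sub_cancel_right]⟩
  left_inv x := by
    refine ext_fst_snd W ?_ ?_
    · simp only [fst_diag, map_sub, map_smul, WithLp.sub_fst, WithLp.smul_fst, fst_shiftSum]
      refine Eq.trans ?_ (hR.left_inv ⟨(W x).fst, x.2.1⟩)
      simp only [map_sub, map_smul]
      module
    · simp only [snd_diag, map_sub, map_add, map_smul, WithLp.sub_snd, WithLp.smul_snd,
        snd_shiftSum]
      refine Eq.trans ?_ (hS.left_inv ⟨(W x).snd, x.2.2⟩)
      simp only [map_sub, map_smul]
      module

theorem mem_eigenspace_shiftSum {x : F} :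
    x ∈ eigenspace (shiftSum W A) z ↔
      (W x).fst ∈ eigenspace A (z + 1) ∧ (W x).snd ∈ eigenspace A (z - 1) := by
  refine (shiftSum_eq_iff W x (z • x)).trans ?_
  simp only [map_smul, WithLp.smul_fst, WithLp.smul_snd]
  change _ ↔ (∃ h : _, _ = (z + 1) • _) ∧ (∃ h : _, _ = (z - 1) • _)
  simp only [add_smul, sub_smul, one_smul]

theorem spec_shiftSum_subset (hz : z ∈ spec (shiftSum W A)) :
    z + 1 ∈ spec A ∨ z - 1 ∈ spec A := by
  by_contra! h
  obtain ⟨R, hR⟩ := notMem_spec_iff.1 h.1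
  obtain ⟨S, hS⟩ := notMem_spec_iff.1 h.2
  exact hz ⟨_, hR.diag W hS⟩

theorem eigenspace_shiftSum_ne_bot (h : eigenspace A (z + 1) ≠ ⊥ ∨ eigenspace A (z - 1) ≠ ⊥) :
    eigenspace (shiftSum W A) z ≠ ⊥ := by
  rw [Submodule.ne_bot_iff]
  rcases h with h | h
  · obtain ⟨x, hx, h0⟩ := Submodule.exists_mem_ne_zero_of_ne_bot h
    refine ⟨W.symm (WithLp.toLp 2 (x, 0)), ?_, fun h => h0 ?_⟩
    · rw [mem_eigenspace_shiftSum]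
      simpa using hx
    · simpa using congrArg (fun y => (W y).fst) h
  · obtain ⟨x, hx, h0⟩ := Submodule.exists_mem_ne_zero_of_ne_bot h
    refine ⟨W.symm (WithLp.toLp 2 (0, x)), ?_, fun h => h0 ?_⟩
    · rw [mem_eigenspace_shiftSum]
      simpa using hx
    · simpa using congrArg (fun y => (W y).snd) h

theorem finiteDimensional_eigenspace_shiftSum
    (h₁ : FiniteDimensional ℂ (eigenspace A (z + 1)))
    (h₂ : FiniteDimensional ℂ (eigenspace A (z - 1))) :
    FiniteDimensional ℂ (eigenspace (shiftSum W A) z) := by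
  let f : eigenspace (shiftSum W A) z →ₗ[ℂ] eigenspace A (z + 1) × eigenspace A (z - 1) :=
    { toFun x := (⟨_, ((mem_eigenspace_shiftSum W).1 x.2).1⟩,
        ⟨_, ((mem_eigenspace_shiftSum W).1 x.2).2⟩)
      map_add' x y := by ext <;> simp
      map_smul' c x := by ext <;> simp }
  refine FiniteDimensional.of_injective f fun x y h => Subtype.ext (ext_fst_snd W ?_ ?_)
  · exact congrArg (fun p => (p.1 : E)) h
  · exact congrArg (fun p => (p.2 : E)) h

theorem PurelyDiscreteSpectrum.finiteDimensional (hA : PurelyDiscreteSpectrum A) (z : ℂ) :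
    FiniteDimensional ℂ (eigenspace A z) := by
  by_cases hz : z ∈ spec A
  · exact (hA z hz).2.2
  · have h : eigenspace A z = ⊥ := by
      by_contra h
      exact hz (mem_spec_of_eigenspace_ne_bot h)
    rw [h]
    infer_instance

theorem PurelyDiscreteSpectrum.shiftSum (hA : PurelyDiscreteSpectrum A) :
    PurelyDiscreteSpectrum (shiftSum W A) := by
  intro z hz
  refine ⟨?_, ?_, ?_⟩
  · obtain ⟨ε₁, h₁, H₁⟩ := hA.exists_dist_lt_imp_eq (z + 1)
    obtain ⟨ε₂, h₂, H₂⟩ := hA.exists_dist_lt_imp_eq (z - 1)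
    refine ⟨min ε₁ ε₂, lt_min h₁ h₂, fun w hw hd => ?_⟩
    rcases spec_shiftSum_subset W hw with h | h
    · have := H₁ _ h (by simpa using hd.trans_le (min_le_left _ _))
      simpa using this
    · have := H₂ _ h (by simpa using hd.trans_le (min_le_right _ _))
      simpa using this
  · exact eigenspace_shiftSum_ne_bot W
      ((spec_shiftSum_subset W hz).imp (fun h => (hA _ h).2.1) fun h => (hA _ h).2.1)
  · exact finiteDimensional_eigenspace_shiftSum W (hA.finiteDimensional _)
      (hA.finiteDimensional _)

theorem BoundedBelow.shiftSum (hA : BoundedBelow A) : BoundedBelow (shiftSum W A) := by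
  obtain ⟨c, hc⟩ := hA
  -- The summand `A - 1` dictates the bound; `A + 1` has room to spare.
  refine ⟨c - 1, fun x => ?_⟩
  have h₁ := hc ⟨(W x).fst, x.2.1⟩
  have h₂ := hc ⟨(W x).snd, x.2.2⟩
  have h₃ : ‖(x : F)‖ ^ 2 = ‖(W x).fst‖ ^ 2 + ‖(W x).snd‖ ^ 2 := by
    rw [← W.norm_map, WithLp.prod_norm_sq_eq_of_L2]
  have h₄ : ∀ y : E, (⟪y, y⟫_ℂ).re = ‖y‖ ^ 2 := fun y => inner_self_eq_norm_sq (𝕜 := ℂ) y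
  rw [inner_eq_fst_add_snd W, fst_shiftSum, snd_shiftSum, inner_sub_right, inner_add_right,
    Complex.add_re, Complex.add_re, Complex.sub_re, h₃, h₄, h₄]
  nlinarith [sq_nonneg ‖(W x).snd‖]

theorem isFormalAdjoint_shiftSum (hA : A.IsFormalAdjoint A) :
    (shiftSum W A).IsFormalAdjoint (shiftSum W A) := by
  intro x y
  have h₁ := hA ⟨(W x).fst, x.2.1⟩ ⟨(W y).fst, y.2.1⟩
  have h₂ := hA ⟨(W x).snd, x.2.2⟩ ⟨(W y).snd, y.2.2⟩
  simp only [inner_eq_fst_add_snd W, fst_shiftSum, snd_shiftSum, inner_sub_left, inner_sub_right,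
    inner_add_left, inner_add_right, h₁, h₂]

/-- Each eigenvalue `r` of `A` yields the eigenvalue `r - 1` of the sum. This inequality suffices to
make both `s - 1` and `s + 1` admissible for `A` once `s` is admissible for the sum. -/
theorem groundEnergy_shiftSum_le [CompleteSpace E] [Nontrivial E] {P : Set E}
    (hA : IsPositivityImproving P A) :
    groundEnergy (shiftSum W A) + 1 ≤ groundEnergy A := by
  refine le_csInf hA.exists_real_mem_spec fun r hr => ?_
  have h : groundEnergy (shiftSum W A) ≤ r - 1 := by
    refine csInf_le ((hA.discrete.shiftSum W).bddBelow (hA.boundedBelow.shiftSum W)) ?_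
    refine mem_spec_of_eigenspace_ne_bot (eigenspace_shiftSum_ne_bot W (Or.inl ?_))
    have e : ((r - 1 : ℝ) : ℂ) + 1 = r := by push_cast; ring
    rw [e]
    exact (hA.discrete _ hr).2.1
  linarith

end Doubling

/-! ### Unitary groups and strong commutation. -/

section UnitaryGroups

variable {E F : Type*} [NormedAddCommGroup E] [InnerProductSpace ℂ E]
  [NormedAddCommGroup F] [InnerProductSpace ℂ F]
  (W : F ≃ₗᵢ[ℂ] WithLp 2 (E × E)) {A : E →ₗ.[ℂ] E} {U : ℝ → E →L[ℂ] E}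

theorem hasDerivAt_cexp_mul_I (c : ℝ) :
    HasDerivAt (fun t : ℝ => Complex.exp ((c * t : ℝ) * Complex.I)) (c * Complex.I) 0 := by
  have h : HasDerivAt (fun t : ℝ => ((c * t : ℝ) : ℂ) * Complex.I) (c * Complex.I) 0 := by
    have := ((hasDerivAt_id (0 : ℝ)).const_mul c).ofReal_comp.mul_const Complex.I
    simpa using this
  simpa using h.cexp

/-- A phase `exp(i c t)` adds `c` to the generator; the converse multiplies by the opposite phase.
-/
theorem hasDerivAt_exp_smul_iff (hU : U 0 = 1) (c : ℝ) (x y : E) :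
    HasDerivAt (fun t : ℝ => Complex.exp ((c * t : ℝ) * Complex.I) • U t x)
        (Complex.I • y) 0 ↔
      HasDerivAt (fun t => U t x) (Complex.I • (y - (c : ℂ) • x)) 0 := by
  constructor
  · intro h
    have h1 := (hasDerivAt_cexp_mul_I (-c)).smul h
    refine (h1.congr_deriv ?_).congr_of_eventuallyEq (Filter.Eventually.of_forall fun t => ?_)
    · simp [hU]; module
    · change U t x = Complex.exp _ • Complex.exp _ • U t x
      rw [smul_smul, ← Complex.exp_add]
      simp
  · intro h
    have h1 := (hasDerivAt_cexp_mul_I c).smul h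
    refine h1.congr_deriv ?_
    simp [hU]; module

theorem hasDerivAt_iff_fst_snd (f : ℝ → F) (f' : F) (t : ℝ) :
    HasDerivAt f f' t ↔ HasDerivAt (fun t => (W (f t)).fst) (W f').fst t ∧
      HasDerivAt (fun t => (W (f t)).snd) (W f').snd t := by
  let L := W.toContinuousLinearEquiv.trans (WithLp.prodContinuousLinearEquiv 2 ℂ E E)
  constructor
  · intro h
    have h1 : HasDerivAt (fun t => L (f t)) (L f') t :=
      (L.toContinuousLinearMap.restrictScalars ℝ).hasFDerivAt.comp_hasDerivAt t h
    exact ⟨h1.fst, h1.snd⟩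
  · rintro ⟨h₁, h₂⟩
    have h1 := (L.symm.toContinuousLinearMap.restrictScalars ℝ).hasFDerivAt.comp_hasDerivAt t
      (h₁.prodMk h₂)
    refine (h1.congr_deriv ?_).congr_of_eventuallyEq (Filter.Eventually.of_forall fun t => ?_)
    · exact L.symm_apply_apply f'
    · exact (L.symm_apply_apply (f t)).symm

/-- The unitary group of `(A - 1) ⊕ (A + 1)`. -/
noncomputable def shiftSumGroup (U : ℝ → E →L[ℂ] E) (t : ℝ) : F →L[ℂ] F :=
  diag W (Complex.exp (((-1 : ℝ) * t : ℝ) * Complex.I) • U t)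
    (Complex.exp (((1 : ℝ) * t : ℝ) * Complex.I) • U t)

variable [CompleteSpace E] [CompleteSpace F]

theorem exp_mul_I_smul_mem_unitary (c : ℝ) {B : E →L[ℂ] E} (hB : B ∈ unitary (E →L[ℂ] E)) :
    Complex.exp (c * Complex.I) • B ∈ unitary (E →L[ℂ] E) := by
  refine Unitary.smul_mem_of_mem ?_ hB
  rw [Unitary.mem_iff_self_mul_star]
  simp only [RCLike.star_def, Complex.mul_conj, Complex.normSq_eq_norm_sq,
    Complex.norm_exp_ofReal_mul_I]
  simp

theorem isUnitaryGroupOf_shiftSumGroup (hU : IsUnitaryGroupOf A U) :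
    IsUnitaryGroupOf (shiftSum W A) (shiftSumGroup W U) where
  unitary t := diag_mem_unitary W (exp_mul_I_smul_mem_unitary _ (hU.unitary t))
    (exp_mul_I_smul_mem_unitary _ (hU.unitary t))
  map_zero := by
    simp [shiftSumGroup, hU.map_zero, diag_one]
  map_add s t := by
    rw [shiftSumGroup, shiftSumGroup, shiftSumGroup, ← diag_mul]
    simp only [smul_mul_smul_comm, ← Complex.exp_add, ← hU.map_add, mul_add, Complex.ofReal_add,
      add_mul]
  continuous x := by
    let L := W.toContinuousLinearEquiv.trans (WithLp.prodContinuousLinearEquiv 2 ℂ E E)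
    have h1 := hU.continuous (W x).fst
    have h2 := hU.continuous (W x).snd
    have h3 : Continuous fun t : ℝ => L.symm
        (Complex.exp (((-1 : ℝ) * t : ℝ) * Complex.I) • U t (W x).fst,
          Complex.exp (((1 : ℝ) * t : ℝ) * Complex.I) • U t (W x).snd) := by
      refine L.symm.continuous.comp ?_
      fun_prop
    exact h3
  generator x y := by
    rw [hasDerivAt_iff_fst_snd W, shiftSum_eq_iff, ← hU.generator, ← hU.generator]
    simp only [shiftSumGroup, fst_diag, snd_diag, smul_apply, map_smul,
      WithLp.smul_fst, WithLp.smul_snd]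
    rw [hasDerivAt_exp_smul_iff hU.map_zero, hasDerivAt_exp_smul_iff hU.map_zero]
    simp

/-- If all `exp(i s B)` commute with `C`, then so does `B`. -/
theorem commute_of_commute_exp {B C : E →L[ℂ] E}
    (h : ∀ s : ℝ, Commute (NormedSpace.exp ((Complex.I * (s : ℂ)) • B)) C) : Commute B C := by
  have h1 : HasDerivAt (fun s : ℝ => NormedSpace.exp ((Complex.I * (s : ℂ)) • B))
      (Complex.I • B) 0 := by
    have h2 := hasDerivAt_exp_smul_const (𝕂 := ℝ) (Complex.I • B) (0 : ℝ)
    refine (h2.congr_deriv (by simp)).congr_of_eventuallyEq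
      (Filter.Eventually.of_forall fun s => ?_)
    simp only [← Complex.coe_smul, smul_smul, mul_comm]
  have h2 : (Complex.I • B) * C = C * (Complex.I • B) := by
    refine (h1.mul_const C).unique ?_
    refine (h1.const_mul C).congr_of_eventuallyEq (Filter.Eventually.of_forall fun s => ?_)
    exact (h s).eq
  rw [smul_mul_assoc, mul_smul_comm] at h2
  exact smul_right_injective _ Complex.I_ne_zero h2

/-- Passing from the exponentials to `B` itself reduces the claim to a product of block-diagonal
operators; the phases are scalars and do no harm. -/
theorem StronglyCommute.shiftSum {B : E →L[ℂ] E} (h : StronglyCommute B A) :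
    StronglyCommute (diag W B 0) (shiftSum W A) := by
  obtain ⟨U, hU, hc⟩ := h
  refine ⟨shiftSumGroup W U, isUnitaryGroupOf_shiftSumGroup W hU, fun s t => ?_⟩
  have h1 : Commute B (U t) := commute_of_commute_exp fun s => hc s t
  have h2 : Commute (diag W B 0) (shiftSumGroup W U t) := by
    rw [Commute, SemiconjBy, shiftSumGroup, ← diag_mul, ← diag_mul, mul_zero, zero_mul,
      (h1.smul_right _).eq]
  exact ((h2.symm.smul_right _).exp_right).symm

end UnitaryGroups

/-! ### The rotation that diagonalizes `σ₁`. -/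

section Hadamard

variable {E : Type*} [NormedAddCommGroup E] [InnerProductSpace ℂ E]

theorem inv_sqrt_two_mul_self : (((√2)⁻¹ : ℝ) : ℂ) * (((√2)⁻¹ : ℝ) : ℂ) = 1 / 2 := by
  rw [← Complex.ofReal_mul, ← mul_inv, Real.mul_self_sqrt zero_le_two]
  simp

/-- The map `(x, y) ↦ ((x + y) / √2, (x - y) / √2)`, as a linear map. -/
noncomputable def hadamardₗ : WithLp 2 (E × E) →ₗ[ℂ] WithLp 2 (E × E) where
  toFun x := WithLp.toLp 2 ((((√2)⁻¹ : ℝ) : ℂ) • (x.fst + x.snd),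
    (((√2)⁻¹ : ℝ) : ℂ) • (x.fst - x.snd))
  map_add' x y := by
    refine WithLp.ofLp_injective 2 (Prod.ext ?_ ?_)
    · simp only [WithLp.ofLp_add, Prod.fst_add, WithLp.add_fst, WithLp.add_snd]; module
    · simp only [WithLp.ofLp_add, Prod.snd_add, WithLp.add_fst, WithLp.add_snd]; module
  map_smul' c x := by
    refine WithLp.ofLp_injective 2 (Prod.ext ?_ ?_)
    · simp only [WithLp.ofLp_smul, Prod.smul_fst, WithLp.smul_fst, WithLp.smul_snd,
        RingHom.id_apply]
      module
    · simp only [WithLp.ofLp_smul, Prod.smul_snd, WithLp.smul_fst, WithLp.smul_snd,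
        RingHom.id_apply]
      module

theorem fst_hadamardₗ (x : WithLp 2 (E × E)) :
    (hadamardₗ x).fst = (((√2)⁻¹ : ℝ) : ℂ) • (x.fst + x.snd) := rfl

theorem snd_hadamardₗ (x : WithLp 2 (E × E)) :
    (hadamardₗ x).snd = (((√2)⁻¹ : ℝ) : ℂ) • (x.fst - x.snd) := rfl

theorem involutive_hadamardₗ : Function.Involutive (hadamardₗ (E := E)) := by
  intro x
  refine WithLp.ofLp_injective 2 (Prod.ext ?_ ?_)
  · change (hadamardₗ (hadamardₗ x)).fst = x.fst
    rw [fst_hadamardₗ (hadamardₗ x), fst_hadamardₗ, snd_hadamardₗ, ← smul_add, smul_smul,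
      inv_sqrt_two_mul_self]
    module
  · change (hadamardₗ (hadamardₗ x)).snd = x.snd
    rw [snd_hadamardₗ (hadamardₗ x), fst_hadamardₗ, snd_hadamardₗ, ← smul_sub, smul_smul,
      inv_sqrt_two_mul_self]
    module

/-- The unitary involution `(x, y) ↦ ((x + y) / √2, (x - y) / √2)`. -/
noncomputable def hadamard : WithLp 2 (E × E) ≃ₗᵢ[ℂ] WithLp 2 (E × E) where
  toLinearEquiv := LinearEquiv.ofInvolutive hadamardₗ involutive_hadamardₗ
  norm_map' x := by
    change ‖hadamardₗ x‖ = ‖x‖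
    have h : ((√2)⁻¹ : ℝ) ^ 2 = 1 / 2 := by
      rw [inv_pow, Real.sq_sqrt zero_le_two, one_div]
    have h2 := parallelogram_law_with_norm ℂ x.fst x.snd
    rw [← sq_eq_sq₀ (norm_nonneg _) (norm_nonneg _), WithLp.prod_norm_sq_eq_of_L2,
      WithLp.prod_norm_sq_eq_of_L2, fst_hadamardₗ, snd_hadamardₗ, norm_smul, norm_smul,
      Complex.norm_real, mul_pow, mul_pow, Real.norm_eq_abs, sq_abs, h]
    linarith

theorem fst_hadamard (x : WithLp 2 (E × E)) :
    (hadamard x).fst = (((√2)⁻¹ : ℝ) : ℂ) • (x.fst + x.snd) := rfl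

theorem snd_hadamard (x : WithLp 2 (E × E)) :
    (hadamard x).snd = (((√2)⁻¹ : ℝ) : ℂ) • (x.fst - x.snd) := rfl

end Hadamard

/-! ### The cone `P ⊕ P` and improvement of positivity. -/

section Cones

variable {E F : Type*} [NormedAddCommGroup E] [InnerProductSpace ℂ E]
  [NormedAddCommGroup F] [InnerProductSpace ℂ F] {P : Set E}

theorem IsSelfDualCone.zero_mem (hP : IsSelfDualCone P) : (0 : E) ∈ P := by
  have h : (0 : E) ∈ P ∩ {x | -x ∈ P} := by rw [hP.pointed]; rfl
  exact h.1

theorem IsSelfDualCone.mem_iff (hP : IsSelfDualCone P) {y : E} :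
    y ∈ P ↔ ∀ x ∈ P, 0 ≤ ⟪y, x⟫_ℂ := by
  conv_lhs => rw [hP.self_dual]
  rfl

theorem IsSelfDualCone.inner_nonneg (hP : IsSelfDualCone P) {x y : E} (hx : x ∈ P) (hy : y ∈ P) :
    0 ≤ ⟪x, y⟫_ℂ :=
  hP.mem_iff.1 hx y hy

theorem IsSelfDualCone.add_mem (hP : IsSelfDualCone P) {x y : E} (hx : x ∈ P) (hy : y ∈ P) :
    x + y ∈ P :=
  hP.mem_iff.2 fun z hz => by
    rw [inner_add_left]
    exact add_nonneg (hP.inner_nonneg hx hz) (hP.inner_nonneg hy hz)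

theorem IsSelfDualCone.smul_mem_iff (hP : IsSelfDualCone P) {c : ℝ} (hc : 0 < c) {x : E} :
    (c : ℂ) • x ∈ P ↔ x ∈ P := by
  refine ⟨fun h => ?_, hP.smul_mem c hc.le x⟩
  have h1 := hP.smul_mem c⁻¹ (inv_nonneg.2 hc.le) _ h
  rwa [smul_smul, ← Complex.ofReal_mul, inv_mul_cancel₀ hc.ne', Complex.ofReal_one,
    one_smul] at h1

theorem StrictlyPositive.add_mem (hP : IsSelfDualCone P) {x y : E} (hx : StrictlyPositive P x)
    (hy : y ∈ P) : StrictlyPositive P (x + y) := by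
  refine ⟨hP.add_mem hx.1 hy, fun z hz h0 => ?_⟩
  rw [inner_add_right]
  exact add_pos_of_pos_of_nonneg (hx.2 z hz h0) (hP.inner_nonneg hz hy)

theorem StrictlyPositive.smul (hP : IsSelfDualCone P) {x : E} (hx : StrictlyPositive P x)
    {c : ℝ} (hc : 0 < c) : StrictlyPositive P ((c : ℂ) • x) := by
  refine ⟨hP.smul_mem c hc.le x hx.1, fun z hz h0 => ?_⟩
  rw [inner_smul_right]
  exact mul_pos (Complex.zero_lt_real.2 hc) (hx.2 z hz h0)

theorem ImprovesPositivity.preserves (hP : IsSelfDualCone P) {B : E →L[ℂ] E}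
    (hB : ImprovesPositivity P B) : PreservesPositivity P B := by
  intro x hx
  by_cases h0 : x = 0
  · rw [h0, map_zero]
    exact hP.zero_mem
  · exact (hB x hx h0).1

theorem ImprovesPositivity.comp {B C : E →L[ℂ] E} (hB : ImprovesPositivity P B)
    (hC : ImprovesPositivity P C) {x : E} (hx : x ∈ P) (h0 : x ≠ 0) :
    StrictlyPositive P (B (C x)) := by
  -- `C x` is nonzero because its inner product with `x` is positive.
  refine hB _ (hC x hx h0).1 fun h => ?_
  have h1 := (hC x hx h0).2 x hx h0
  rw [h, inner_zero_right] at h1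
  exact lt_irrefl _ h1

variable (V : F ≃ₗᵢ[ℂ] WithLp 2 (E × E))

/-- The cone `P ⊕ P`, transported along `V`. -/
def sumCone (P : Set E) : Set F := {x | (V x).fst ∈ P ∧ (V x).snd ∈ P}

theorem mem_sumCone {x : F} : x ∈ sumCone V P ↔ (V x).fst ∈ P ∧ (V x).snd ∈ P := Iff.rfl

theorem IsSelfDualCone.sumCone (hP : IsSelfDualCone P) : IsSelfDualCone (sumCone V P) where
  closed := by
    have h₁ : Continuous fun x => (V x).fst := (WithLp.fstL 2 ℂ E E).continuous.comp V.continuous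
    have h₂ : Continuous fun x => (V x).snd := (WithLp.sndL 2 ℂ E E).continuous.comp V.continuous
    exact (hP.closed.preimage h₁).inter (hP.closed.preimage h₂)
  convex := by
    intro x hx y hy a b ha hb hab
    have h₁ := hP.convex hx.1 hy.1 ha hb hab
    have h₂ := hP.convex hx.2 hy.2 ha hb hab
    simp only [← Complex.coe_smul] at h₁ h₂ ⊢
    simp only [mem_sumCone, map_add, map_smul, WithLp.add_fst, WithLp.add_snd, WithLp.smul_fst,
      WithLp.smul_snd]
    exact ⟨h₁, h₂⟩
  smul_mem t ht x hx := by
    simp only [mem_sumCone, map_smul, WithLp.smul_fst, WithLp.smul_snd]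
    exact ⟨hP.smul_mem t ht _ hx.1, hP.smul_mem t ht _ hx.2⟩
  pointed := by
    ext x
    constructor
    · rintro ⟨hx, hx'⟩
      rw [Set.mem_ofPred_eq, mem_sumCone] at hx'
      simp only [map_neg, WithLp.neg_fst, WithLp.neg_snd] at hx'
      have h₁ : (V x).fst ∈ P ∩ {x | -x ∈ P} := ⟨hx.1, hx'.1⟩
      have h₂ : (V x).snd ∈ P ∩ {x | -x ∈ P} := ⟨hx.2, hx'.2⟩
      rw [hP.pointed, Set.mem_singleton_iff] at h₁ h₂
      exact ext_fst_snd V (by simpa using h₁) (by simpa using h₂)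
    · rintro rfl
      have h : (0 : F) ∈ Stability.sumCone V P := by
        rw [mem_sumCone]
        simpa using hP.zero_mem
      exact ⟨h, by simpa using h⟩
  self_dual := by
    ext y
    constructor
    · intro hy x hx
      rw [inner_eq_fst_add_snd V]
      exact add_nonneg (hP.inner_nonneg hy.1 hx.1) (hP.inner_nonneg hy.2 hx.2)
    · intro hy
      refine ⟨hP.mem_iff.2 fun x hx => ?_, hP.mem_iff.2 fun x hx => ?_⟩
      · have h := hy (V.symm (WithLp.toLp 2 (x, 0))) (by
          rw [mem_sumCone]; simpa using ⟨hx, hP.zero_mem⟩)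
        rw [inner_eq_fst_add_snd V] at h
        simpa using h
      · have h := hy (V.symm (WithLp.toLp 2 (0, x))) (by
          rw [mem_sumCone]; simpa using ⟨hP.zero_mem, hx⟩)
        rw [inner_eq_fst_add_snd V] at h
        simpa using h

theorem StrictlyPositive.sumCone {x : F} (h₁ : StrictlyPositive P (V x).fst)
    (h₂ : StrictlyPositive P (V x).snd) (hP : IsSelfDualCone P) :
    StrictlyPositive (sumCone V P) x := by
  refine ⟨⟨h₁.1, h₂.1⟩, fun y hy h0 => ?_⟩
  rw [inner_eq_fst_add_snd V]
  by_cases h : (V y).fst = 0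
  · have h' : (V y).snd ≠ 0 := fun h' => h0 (ext_fst_snd V (by simpa using h) (by simpa using h'))
    exact add_pos_of_nonneg_of_pos (hP.inner_nonneg hy.1 h₁.1) (h₂.2 _ hy.2 h')
  · exact add_pos_of_pos_of_nonneg (h₁.2 _ hy.1 h) (hP.inner_nonneg hy.2 h₂.1)

variable (W : F ≃ₗᵢ[ℂ] WithLp 2 (E × E))

theorem fst_eq_hadamard (x : F) : (W x).fst =
    (((√2)⁻¹ : ℝ) : ℂ) • (((W.trans hadamard) x).fst + ((W.trans hadamard) x).snd) :=
  (congrArg WithLp.fst (involutive_hadamardₗ (W x))).symm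

theorem snd_eq_hadamard (x : F) : (W x).snd =
    (((√2)⁻¹ : ℝ) : ℂ) • (((W.trans hadamard) x).fst - ((W.trans hadamard) x).snd) :=
  (congrArg WithLp.snd (involutive_hadamardₗ (W x))).symm

variable {R S : E →L[ℂ] E}

/-- The off-diagonal entry `(R - S)/2`, whose positivity is not visible, is rewritten as the
composition `R S`. -/
theorem fst_hadamard_diag (h : ∀ y, R y - S y = (2 : ℂ) • R (S y)) (x : F) :
    ((W.trans hadamard) (diag W R S x)).fst =
      ((1 / 2 : ℝ) : ℂ) • (R ((W.trans hadamard) x).fst + S ((W.trans hadamard) x).fst) +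
        R (S ((W.trans hadamard) x).snd) := by
  have h₁ : R (S ((W.trans hadamard) x).snd) = ((1 / 2 : ℝ) : ℂ) •
      (R ((W.trans hadamard) x).snd - S ((W.trans hadamard) x).snd) := by
    rw [h, smul_smul]; norm_num
  rw [h₁, LinearIsometryEquiv.trans_apply, fst_hadamard, fst_diag, snd_diag, fst_eq_hadamard W x,
    snd_eq_hadamard W x, map_smul, map_smul, ← smul_add, smul_smul, inv_sqrt_two_mul_self, map_add,
    map_sub]
  push_cast
  module

theorem snd_hadamard_diag (h : ∀ y, R y - S y = (2 : ℂ) • R (S y)) (x : F) :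
    ((W.trans hadamard) (diag W R S x)).snd =
      ((1 / 2 : ℝ) : ℂ) • (R ((W.trans hadamard) x).snd + S ((W.trans hadamard) x).snd) +
        R (S ((W.trans hadamard) x).fst) := by
  have h₁ : R (S ((W.trans hadamard) x).fst) = ((1 / 2 : ℝ) : ℂ) •
      (R ((W.trans hadamard) x).fst - S ((W.trans hadamard) x).fst) := by
    rw [h, smul_smul]; norm_num
  rw [h₁, LinearIsometryEquiv.trans_apply, snd_hadamard, fst_diag, snd_diag, fst_eq_hadamard W x,
    snd_eq_hadamard W x, map_smul, map_smul, ← smul_sub, smul_smul, inv_sqrt_two_mul_self, map_add,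
    map_sub]
  push_cast
  module

/-- If `p, q` lie in the cone and one of them is nonzero, then `(R p + S p) / 2 + R S q` is strictly
positive. -/
theorem ImprovesPositivity.strictlyPositive_add (hP : IsSelfDualCone P)
    (hR : ImprovesPositivity P R) (hS : ImprovesPositivity P S) {p q : E} (hp : p ∈ P)
    (hq : q ∈ P) (h : p ≠ 0 ∨ q ≠ 0) :
    StrictlyPositive P (((1 / 2 : ℝ) : ℂ) • (R p + S p) + R (S q)) := by
  by_cases h0 : p = 0
  · subst h0
    simpa using hR.comp hS hq (h.resolve_left (by simp))
  · refine StrictlyPositive.add_mem hP (StrictlyPositive.smul hP ?_ (by norm_num))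
      (hR.preserves hP _ (hS.preserves hP _ hq))
    exact (hR p hp h0).add_mem hP (hS.preserves hP _ hp)

theorem ImprovesPositivity.diag (hP : IsSelfDualCone P)
    (hR : ImprovesPositivity P R) (hS : ImprovesPositivity P S)
    (h : ∀ y, R y - S y = (2 : ℂ) • R (S y)) :
    ImprovesPositivity (Stability.sumCone (W.trans hadamard) P) (diag W R S) := by
  intro x hx h0
  have hne : ((W.trans hadamard) x).fst ≠ 0 ∨ ((W.trans hadamard) x).snd ≠ 0 := by
    by_contra! h'
    exact h0 (ext_fst_snd (W.trans hadamard) (by rw [h'.1, map_zero]; rfl)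
      (by rw [h'.2, map_zero]; rfl))
  refine StrictlyPositive.sumCone _ ?_ ?_ hP
  · rw [fst_hadamard_diag W h]
    exact hR.strictlyPositive_add hP hS hx.1 hx.2 hne
  · rw [snd_hadamard_diag W h]
    exact hR.strictlyPositive_add hP hS hx.2 hx.1 hne.symm

theorem IsPositivityImproving.shiftSum [CompleteSpace E] [CompleteSpace F] [Nontrivial E]
    {A : E →ₗ.[ℂ] E} (hP : IsSelfDualCone P) (hA : IsPositivityImproving P A) :
    IsPositivityImproving (Stability.sumCone (W.trans hadamard) P) (shiftSum W A) := by
  have hres : ∀ s : ℝ, -groundEnergy (Stability.shiftSum W A) < s → ∃ R : F →L[ℂ] F,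
      IsResolvent (Stability.shiftSum W A) (-(s : ℂ)) R ∧
        ImprovesPositivity (Stability.sumCone (W.trans hadamard) P) R := by
    intro s hs
    have hE := groundEnergy_shiftSum_le W hA
    -- The resolvents of `A - 1` and `A + 1` at `-s` are those of `A` at `-(s - 1)` and `-(s + 1)`.
    -- These points differ by 2, the factor in the resolvent identity below.
    obtain ⟨R, hR, hR'⟩ := hA.improves (s - 1) (by linarith)
    obtain ⟨S, hS, hS'⟩ := hA.improves (s + 1) (by linarith)
    have e₁ : -((s - 1 : ℝ) : ℂ) = -(s : ℂ) + 1 := by push_cast; ring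
    have e₂ : -((s + 1 : ℝ) : ℂ) = -(s : ℂ) - 1 := by push_cast; ring
    rw [e₁] at hR
    rw [e₂] at hS
    refine ⟨_, hR.diag W hS, hR'.diag W hP hS' fun y => ?_⟩
    rw [hR.sub_apply hS]
    congr 1
    ring
  refine ⟨?_, hA.boundedBelow.shiftSum W, hA.discrete.shiftSum W, hres⟩
  -- Any real point below the spectrum would do.
  obtain ⟨R, hR, -⟩ := hres (-groundEnergy (Stability.shiftSum W A) + 1) (by linarith)
  rw [← Complex.ofReal_neg] at hR
  exact isSelfAdjoint_of_isResolvent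
    (isFormalAdjoint_shiftSum W hA.isFormalAdjoint) hR

end Cones

/-! ### A set-theoretic model of `X ⊕ X` literally containing `X`. -/

section Carriers

/-- The norm on the type `α` obtained by transport along a bijection. -/
abbrev normedAddCommGroupOfEquiv {α M : Type*} [NormedAddCommGroup M] (e : α ≃ M) :
    NormedAddCommGroup α :=
  letI := e.addCommGroup
  NormedAddCommGroup.induced α M e.addEquiv e.injective

/-- The inner product on the type `α` obtained by transport along a bijection. -/
noncomputable abbrev innerProductSpaceOfEquiv {α M : Type*} [NormedAddCommGroup M] [InnerProductSpace ℂ M]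
    (e : α ≃ M) :
    letI := normedAddCommGroupOfEquiv e
    InnerProductSpace ℂ α :=
  letI := e.addCommGroup
  letI := e.module ℂ
  InnerProductSpace.induced (e.linearEquiv ℂ)

/-- A bijection as a unitary map, for the transported structure on the domain. -/
noncomputable def isometryOfEquiv {α M : Type*} [NormedAddCommGroup M] [InnerProductSpace ℂ M] (e : α ≃ M) :
    letI := normedAddCommGroupOfEquiv e
    letI := innerProductSpaceOfEquiv e
    α ≃ₗᵢ[ℂ] M :=
  letI := normedAddCommGroupOfEquiv e
  letI := innerProductSpaceOfEquiv e
  { toFun := e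
    invFun := e.symm
    left_inv := e.left_inv
    right_inv := e.right_inv
    map_add' := fun _ _ => e.apply_symm_apply _
    map_smul' := fun _ _ => e.apply_symm_apply _
    norm_map' := fun _ => rfl }

variable (X : HilbertSpace.{u}) (s : ZFSet.{u})

open Classical in
/-- The set coding the pair `p`: pairs `(x, 0)` are coded by `x` itself, all other pairs by sets
which are not in `X` and which depend on the tag `s`. -/
noncomputable def pairCode (p : WithLp 2 (X × X)) : ZFSet.{u} :=
  if p.snd = 0 then p.fst else ZFSet.pair (ZFSet.pair X.carrier s) (ZFSet.pair p.fst p.snd)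

/-- By rank: the nested pair is built over `X.carrier` and so outranks it, whereas members of
`X.carrier` have smaller rank. -/
theorem pair_pair_notMem (t v : ZFSet.{u}) :
    ZFSet.pair (ZFSet.pair X.carrier t) v ∉ X.carrier := by
  have key : ∀ a b : ZFSet.{u}, a.rank < (ZFSet.pair a b).rank := fun a b =>
    (ZFSet.rank_lt_of_mem (ZFSet.mem_singleton.2 rfl)).trans
      (ZFSet.rank_lt_of_mem (show {a} ∈ ZFSet.pair a b by simp [ZFSet.pair]))
  intro h
  exact lt_irrefl _ ((ZFSet.rank_lt_of_mem h).trans ((key _ _).trans (key _ _)))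

theorem pairCode_of_snd_eq_zero {p : WithLp 2 (X × X)} (h : p.snd = 0) :
    pairCode X s p = p.fst := if_pos h

theorem pairCode_of_snd_ne_zero {p : WithLp 2 (X × X)} (h : p.snd ≠ 0) :
    pairCode X s p = ZFSet.pair (ZFSet.pair X.carrier s) (ZFSet.pair p.fst p.snd) := if_neg h

theorem pairCode_injective : Function.Injective (pairCode X s) := by
  intro p q h
  refine WithLp.ofLp_injective 2 ?_
  by_cases hp : p.snd = 0 <;> by_cases hq : q.snd = 0
  · rw [pairCode_of_snd_eq_zero X s hp, pairCode_of_snd_eq_zero X s hq] at h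
    exact Prod.ext (Subtype.ext h) (hp.trans hq.symm)
  · rw [pairCode_of_snd_eq_zero X s hp, pairCode_of_snd_ne_zero X s hq] at h
    exact absurd (h ▸ p.fst.2) (pair_pair_notMem X _ _)
  · rw [pairCode_of_snd_ne_zero X s hp, pairCode_of_snd_eq_zero X s hq] at h
    exact absurd (h ▸ q.fst.2) (pair_pair_notMem X _ _)
  · rw [pairCode_of_snd_ne_zero X s hp, pairCode_of_snd_ne_zero X s hq, ZFSet.pair_inj] at h
    have h' := ZFSet.pair_inj.1 h.2
    exact Prod.ext (Subtype.ext h'.1) (Subtype.ext h'.2)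

instance : Small.{u} (WithLp 2 (X × X)) :=
  small_of_injective (WithLp.ofLp_injective 2)

/-- The set of all codes of pairs. -/
noncomputable def doubleCarrier : ZFSet.{u} := ZFSet.range (pairCode X s)

/-- The bijection between the codes and the pairs. -/
noncomputable def doubleEquiv : doubleCarrier X s ≃ WithLp 2 (X × X) :=
  (Equiv.ofBijective (fun p => (⟨pairCode X s p, ZFSet.mem_range_self p⟩ : doubleCarrier X s))
    ⟨fun _ _ h => pairCode_injective X s (congrArg Subtype.val h),
      fun x => (ZFSet.mem_range.1 x.2).imp fun _ h => Subtype.ext h⟩).symm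

/-- The Hilbert space `X ⊕ X`, realized on a set which contains `X` in such a way that `x ∈ X`
stands for `(x, 0)`. -/
noncomputable def doubleSpace : HilbertSpace.{u} :=
  letI := normedAddCommGroupOfEquiv (doubleEquiv X s)
  letI := innerProductSpaceOfEquiv (doubleEquiv X s)
  { carrier := doubleCarrier X s
    complete := (completeSpace_congr (isometryOfEquiv (doubleEquiv X s)).isometry.isUniformEmbedding
      |>.2 inferInstance)
    nontrivial := (doubleEquiv X s).nontrivial }

noncomputable def doubleIso : doubleSpace X s ≃ₗᵢ[ℂ] WithLp 2 (X × X) :=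
  isometryOfEquiv (doubleEquiv X s)

theorem coe_doubleIso_symm (p : WithLp 2 (X × X)) :
    ((doubleIso X s).symm p : ZFSet.{u}) = pairCode X s p := rfl

end Carriers

/-! ### Composition of literal inclusions. -/

namespace IsClosedSubspace

variable {X Y Z : HilbertSpace.{u}}

theorem incl_unique (h : IsClosedSubspace X Y) {x : X} {y : Y}
    (hxy : (y : ZFSet.{u}) = (x : ZFSet.{u})) : h.incl x = y :=
  Subtype.ext ((h.coe_incl x).trans hxy.symm)

theorem carrier_subset (h : IsClosedSubspace X Y) : X.carrier ⊆ Y.carrier := fun z hz => by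
  have h1 := (h.incl ⟨z, hz⟩).2
  rwa [h.coe_incl] at h1

theorem inner_toSub (h : IsClosedSubspace X Y) (x : X) (y : Y) :
    ⟪x, h.toSub y⟫_ℂ = ⟪h.incl x, y⟫_ℂ := by
  rw [toSub, ContinuousLinearMap.adjoint_inner_right]
  rfl

theorem trans (h₁ : IsClosedSubspace X Y) (h₂ : IsClosedSubspace Y Z) : IsClosedSubspace X Z :=
  ⟨h₂.incl.comp h₁.incl, fun x => (h₂.coe_incl _).trans (h₁.coe_incl x)⟩

/-- Extending `O` in stages agrees with extending it at once, so a double inherits commutation from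
the Hamiltonian it doubles. -/
theorem extend_extend (h₁ : IsClosedSubspace X Y) (h₂ : IsClosedSubspace Y Z)
    (h : IsClosedSubspace X Z) (B : X →L[ℂ] X) : h₂.extend (h₁.extend B) = h.extend B := by
  have hi : ∀ x, h.incl x = h₂.incl (h₁.incl x) := fun x =>
    h.incl_unique ((h₂.coe_incl _).trans (h₁.coe_incl x))
  have hs : ∀ z, h.toSub z = h₁.toSub (h₂.toSub z) := fun z =>
    ext_inner_left ℂ fun x => by rw [inner_toSub, inner_toSub, inner_toSub, hi]
  ext1 z
  change h₂.incl (h₁.incl (B (h₁.toSub (h₂.toSub z)))) = h.incl (B (h.toSub z))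
  rw [hi, hs]

end IsClosedSubspace

/-! ### Embedding, projection and cone in the doubled space. -/

section DoubleSpace

variable (X : HilbertSpace.{u}) (s : ZFSet.{u})

theorem coe_doubleIso_symm_inl (x : X) :
    ((doubleIso X s).symm (WithLp.toLp 2 (x, 0)) : ZFSet.{u}) = x :=
  (coe_doubleIso_symm X s _).trans (pairCode_of_snd_eq_zero X s rfl)

theorem isClosedSubspace_double : IsClosedSubspace X (doubleSpace X s) := by
  refine ⟨⟨(doubleIso X s).symm.toLinearEquiv.toLinearMap ∘ₗ
    (WithLp.linearEquiv 2 ℂ (X × X)).symm.toLinearMap ∘ₗ LinearMap.inl ℂ X X, fun x => ?_⟩,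
    coe_doubleIso_symm_inl X s⟩
  refine ((doubleIso X s).symm.norm_map _).trans ?_
  rw [← sq_eq_sq₀ (norm_nonneg _) (norm_nonneg _), WithLp.prod_norm_sq_eq_of_L2]
  simp

variable {X s} (h : IsClosedSubspace X (doubleSpace X s))
include h

theorem incl_double (x : X) : h.incl x = (doubleIso X s).symm (WithLp.toLp 2 (x, 0)) :=
  h.incl_unique (coe_doubleIso_symm_inl X s x)

theorem doubleIso_incl (x : X) : doubleIso X s (h.incl x) = WithLp.toLp 2 (x, 0) := by
  rw [incl_double h, LinearIsometryEquiv.apply_symm_apply]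

theorem toSub_double (y : doubleSpace X s) : h.toSub y = (doubleIso X s y).fst := by
  refine ext_inner_left ℂ fun x => ?_
  rw [h.inner_toSub, inner_eq_fst_add_snd (doubleIso X s), doubleIso_incl h]
  simp

theorem extend_double (B : X →L[ℂ] X) : h.extend B = diag (doubleIso X s) B 0 := by
  ext1 y
  change h.incl (B (h.toSub y)) = _
  refine ext_fst_snd (doubleIso X s) ?_ ?_
  · rw [doubleIso_incl h, fst_diag, toSub_double h]
    rfl
  · rw [doubleIso_incl h, snd_diag]
    rfl

/-- In unrotated coordinates the embedding is `x ↦ (x, x)/√2` and its adjoint is `(x, y) ↦ (x +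
y)/√2`; both respect the cones. -/
theorem coneInherited_double {P : Set X} (hP : IsSelfDualCone P) :
    ConeInherited P (sumCone ((doubleIso X s).trans hadamard) P) := by
  have hc : 0 < (√2)⁻¹ := by positivity
  have hincl : ∀ x ∈ P, h.incl x ∈ sumCone ((doubleIso X s).trans hadamard) P := by
    intro x hx
    rw [mem_sumCone, LinearIsometryEquiv.trans_apply, fst_hadamard, snd_hadamard,
      doubleIso_incl h, hP.smul_mem_iff hc, hP.smul_mem_iff hc]
    simpa using hx
  have hsub : ∀ y ∈ sumCone ((doubleIso X s).trans hadamard) P, h.toSub y ∈ P := by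
    intro y hy
    rw [toSub_double h, fst_eq_hadamard (doubleIso X s), hP.smul_mem_iff hc]
    exact hP.add_mem hy.1 hy.2
  refine ⟨h, Set.Subset.antisymm ?_ ?_, fun y hy => hincl _ (hsub y hy)⟩
  · rintro _ ⟨x, hx, rfl⟩
    exact ⟨h.incl x, hincl x hx, congrArg h.incl (h.toSub_incl x)⟩
  · rintro _ ⟨y, hy, rfl⟩
    exact ⟨h.toSub y, hsub y hy, rfl⟩

end DoubleSpace

/-! ### The doubled Hamiltonian, strictness and uncountability. -/

section DoubleHamiltonian

variable {X₀ : HilbertSpace.{u}} {O : X₀ →L[ℂ] X₀}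

/-- The Hamiltonian `H ⊗ 1 - 1 ⊗ σ₁`, realized on the extension of the Hilbert space of `H` which
belongs to the tag `s`. -/
noncomputable def Hamiltonian.double (H : Hamiltonian X₀ O) (s : ZFSet.{u}) :
    Hamiltonian X₀ O where
  space := doubleSpace H.space s
  sub := H.sub.trans (isClosedSubspace_double H.space s)
  op := shiftSum (doubleIso H.space s) H.op
  exists_cone := by
    obtain ⟨P, hP, hH⟩ := H.exists_cone
    exact ⟨_, hP.sumCone _, hH.shiftSum _ hP⟩
  commute := by
    rw [← H.sub.extend_extend (isClosedSubspace_double H.space s), extend_double]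
    exact H.commute.shiftSum _

/-- The cone `P ⊗ (1, 0) + P ⊗ (0, 1)` in the Hilbert space of `H.double s`. -/
noncomputable def doubleCone (H : Hamiltonian X₀ O) (s : ZFSet.{u}) (P : Set H.space) :
    Set (H.double s).space :=
  (sumCone ((doubleIso H.space s).trans hadamard) P : Set (doubleSpace H.space s))

variable (H : Hamiltonian X₀ O) (s : ZFSet.{u}) {P : Set H.space}

theorem strictlyInherited_double (hP : IsSelfDualCone P) (hH : IsPositivityImproving P H.op) :
    StrictlyInherited H P (H.double s) (doubleCone H s P) where
  cone_left := hP
  cone_right := hP.sumCone _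
  left := hH
  right := hH.shiftSum _ hP
  inherited := coneInherited_double (isClosedSubspace_double H.space s) hP

theorem mem_graph_iff_exists_domain {E : Type*} [NormedAddCommGroup E] [InnerProductSpace ℂ E]
    {A : E →ₗ.[ℂ] E} {x y : E} : (x, y) ∈ A.graph ↔ ∃ h : x ∈ A.domain, A ⟨x, h⟩ = y := by
  rw [LinearPMap.mem_graph_iff]
  exact ⟨fun ⟨⟨_, h⟩, e, e'⟩ => by subst e; exact ⟨h, e'⟩, fun ⟨h, e⟩ => ⟨⟨x, h⟩, rfl, e⟩⟩

theorem smul_add_mem_and_smul_sub_mem_iff {M : Type*} [AddCommGroup M] [Module ℂ M]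
    (G : Submodule ℂ M) {c : ℂ} (hc : c ≠ 0) {v w : M} :
    c • (v + w) ∈ G ∧ c • (v - w) ∈ G ↔ v ∈ G ∧ w ∈ G := by
  rw [G.smul_mem_iff hc, G.smul_mem_iff hc]
  refine ⟨fun h => ⟨?_, ?_⟩, fun h => ⟨G.add_mem h.1 h.2, G.sub_mem h.1 h.2⟩⟩
  · have e : v = (1 / 2 : ℂ) • ((v + w) + (v - w)) := by module
    rw [e]
    exact G.smul_mem _ (G.add_mem h.1 h.2)
  · have e : w = (1 / 2 : ℂ) • ((v + w) - (v - w)) := by module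
    rw [e]
    exact G.smul_mem _ (G.sub_mem h.1 h.2)

theorem isSpinDoubling_double (P : Set H.space) :
    IsSpinDoubling H P (H.double s) (doubleCone H s P) := by
  let W := doubleIso H.space s
  have hc : (((√2)⁻¹ : ℝ) : ℂ) ≠ 0 := by
    rw [Complex.ofReal_ne_zero]
    positivity
  refine ⟨W.trans hadamard, fun x y => (shiftSum_eq_iff W x y).trans ?_, fun x => Iff.rfl⟩
  -- Read through the graph of `H.op`, a linear subspace, the two formulations differ by the
  -- Hadamard rotation of a pair of graph elements: `v` and `w` encode the spin form, their scaled
  -- sum and difference the diagonal form.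
  have key := smul_add_mem_and_smul_sub_mem_iff H.op.graph hc
    (v := (((W.trans hadamard) x).fst,
      ((W.trans hadamard) y).fst + ((W.trans hadamard) x).snd))
    (w := (((W.trans hadamard) x).snd,
      ((W.trans hadamard) y).snd + ((W.trans hadamard) x).fst))
  rw [Prod.mk_add_mk, Prod.mk_sub_mk, Prod.smul_mk, Prod.smul_mk, mem_graph_iff_exists_domain,
    mem_graph_iff_exists_domain, mem_graph_iff_exists_domain, mem_graph_iff_exists_domain] at key
  refine Iff.trans ?_ (key.trans ?_)
  · have e₁ : (W y).fst + (W x).fst = (((√2)⁻¹ : ℝ) : ℂ) •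
        (((W.trans hadamard) y).fst + ((W.trans hadamard) x).snd +
          (((W.trans hadamard) y).snd + ((W.trans hadamard) x).fst)) := by
      rw [fst_eq_hadamard W x, fst_eq_hadamard W y]
      module
    have e₂ : (W y).snd - (W x).snd = (((√2)⁻¹ : ℝ) : ℂ) •
        (((W.trans hadamard) y).fst + ((W.trans hadamard) x).snd -
          (((W.trans hadamard) y).snd + ((W.trans hadamard) x).fst)) := by
      rw [snd_eq_hadamard W x, snd_eq_hadamard W y]
      module
    simp only [← e₁, ← e₂, ← fst_eq_hadamard W x, ← snd_eq_hadamard W x]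
  · constructor
    · rintro ⟨⟨h₁, e₁⟩, h₂, e₂⟩
      exact ⟨h₁, h₂, eq_sub_of_add_eq e₁.symm, eq_sub_of_add_eq e₂.symm⟩
    · rintro ⟨h₁, h₂, e₁, e₂⟩
      exact ⟨⟨h₁, (add_eq_of_eq_sub e₁).symm⟩, h₂, (add_eq_of_eq_sub e₂).symm⟩

theorem le_double : H ≤ H.double s := by
  obtain ⟨P, hP, hH⟩ := H.exists_cone
  exact Relation.TransGen.single ⟨P, _, strictlyInherited_double H s hP hH⟩

variable {H}

/-- The carrier is the invariant that rules out arrows: cones may change along a chain, but each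
link includes one carrier in the next. -/
theorem carrier_subset_of_le {K : Hamiltonian X₀ O} (h : H ≤ K) :
    H.space.carrier ⊆ K.space.carrier := by
  induction h with
  | single h =>
    obtain ⟨_, _, ⟨_, _, _, _, h, _⟩⟩ := h
    exact h.carrier_subset
  | tail _ h ih =>
    obtain ⟨_, _, ⟨_, _, _, _, h, _⟩⟩ := h
    exact fun z hz => h.carrier_subset (ih hz)

variable (H)

/-- The extension of the Hilbert space which belongs to the tag `s` contains a set which is neither
in the given Hilbert space nor in the extension for any other tag. -/
theorem exists_mem_double : ∃ z ∈ (H.double s).space.carrier, z ∉ H.space.carrier ∧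
    ∀ t, z ∈ (H.double t).space.carrier → s = t := by
  obtain ⟨v, hv⟩ := exists_ne (0 : H.space)
  -- A nonzero second component forces a tagged code, from which injectivity of pairing recovers
  -- `s`.
  let p : WithLp 2 (H.space × H.space) := WithLp.toLp 2 (0, v)
  have e := pairCode_of_snd_ne_zero H.space s (p := p) hv
  refine ⟨pairCode H.space s p, ZFSet.mem_range_self p, ?_, fun t ht => ?_⟩
  · rw [e]
    exact pair_pair_notMem _ _ _
  · obtain ⟨q, hq⟩ := ZFSet.mem_range.1 ht
    by_cases hq0 : q.snd = 0
    · rw [pairCode_of_snd_eq_zero _ _ hq0, e] at hq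
      exact absurd (hq ▸ q.fst.2) (pair_pair_notMem _ _ _)
    · rw [pairCode_of_snd_ne_zero _ _ hq0, e, ZFSet.pair_inj, ZFSet.pair_inj] at hq
      exact hq.1.2.symm

theorem lt_double : H < H.double s := by
  refine lt_of_le_not_ge (le_double H s) fun h => ?_
  obtain ⟨z, hz, hz', -⟩ := exists_mem_double H s
  exact hz' (carrier_subset_of_le h hz)

theorem toClass_double_injective : Function.Injective fun s => toClass (H.double s) := by
  intro s t h
  obtain ⟨z, hz, -, hz'⟩ := exists_mem_double H s
  have h1 : H.double s ≤ H.double t :=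
    toAntisymmetrization_le_toAntisymmetrization_iff.1 h.le
  exact hz' t (carrier_subset_of_le h1 hz)

/-- Von Neumann ordinals serve as tags; the type `Ordinal.{u}` is uncountable. -/
theorem uncountable_stabilityClass : Uncountable (stabilityClass (toClass H)) := by
  have h : Function.Injective fun o : Ordinal.{u} =>
      (⟨toClass (H.double o.toZFSet),
        toAntisymmetrization_le_toAntisymmetrization_iff.2 (le_double H _)⟩ :
          stabilityClass (toClass H)) := fun _ _ h =>
    Ordinal.toZFSet_injective (toClass_double_injective H (congrArg Subtype.val h))
  exact h.uncountable

end DoubleHamiltonian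

end Stability

theorem theorem3p4 (X₀ : Stability.HilbertSpace.{u}) (O : X₀ →L[ℂ] X₀) (hO : IsSelfAdjoint O)
    (H : Stability.Hamiltonian X₀ O) :
    Cardinal.aleph0 < Cardinal.mk (Stability.stabilityClass (Stability.toClass H)) ∧
    ∀ P : Set H.space, Stability.IsSelfDualCone P → Stability.IsPositivityImproving P H.op →
      ∃ K : ℕ → Σ L : Stability.Hamiltonian X₀ O, Set L.space,
        K 0 = ⟨H, P⟩ ∧
        (∀ n, Stability.StrictlyInherited (K n).1 (K n).2 (K (n + 1)).1 (K (n + 1)).2 ∧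
          Stability.IsSpinDoubling (K n).1 (K n).2 (K (n + 1)).1 (K (n + 1)).2) ∧
        StrictMono fun n => Stability.toClass (K n).1 := by
  refine ⟨Cardinal.aleph0_lt_mk_iff.2 (Stability.uncountable_stabilityClass H),
    fun P hP hH => ?_⟩
  -- A constant tag suffices: each code also contains the current carrier, so every doubling adds
  -- new sets.
  let K : ℕ → Σ L : Stability.Hamiltonian X₀ O, Set L.space := fun n =>
    n.rec ⟨H, P⟩ fun _ L => ⟨L.1.double ∅, Stability.doubleCone L.1 ∅ L.2⟩
  have hK : ∀ n, Stability.IsSelfDualCone (K n).2 ∧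
      Stability.IsPositivityImproving (K n).2 (K n).1.op := by
    intro n
    induction n with
    | zero => exact ⟨hP, hH⟩
    | succ n ih =>
      have h := Stability.strictlyInherited_double (K n).1 ∅ ih.1 ih.2
      exact ⟨h.cone_right, h.right⟩
  exact ⟨K, rfl, fun n => ⟨Stability.strictlyInherited_double _ _ (hK n).1 (hK n).2,
    Stability.isSpinDoubling_double _ _ _⟩, strictMono_nat_of_lt_succ fun n =>
      toAntisymmetrization_lt_toAntisymmetrization_iff.2 (Stability.lt_double (K n).1 ∅)⟩
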